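/- **Setting.** Let $\mathcal S,\mathcal A$ be finite non-empty sets with $|\mathcal S|=S$, $|\mathcal A|=A$, let $H$ be a horizon, $\rho$ an initial distribution on $\mathcal S$, $P^\star$ an unknown transition function ($P^\star(s,a,\cdot)$ is a probability distribution on $\mathcal S$ for all $s,a$), and $r_1,\dots,r_n:\mathcal S\times\mathcal A\to[0,1]$ known reward functions. A policy is $\pi=(\pi_1,\dots,\pi_H)$ where $\pi_h(\cdot\mid s)$ is a distribution on $\mathcal A$. In an episode, $s_1\sim\rho$, $a_h\sim\pi_h(\cdot\mid s_h)$ for $h=1,\dots,H$, and $s_{h+1}\sim P(s_h,a_h,\cdot)$ for $h=1,\dots,H-1$; put $V^\pi(r_i;P)=\mathbb E_{\pi,P}\big[\sum_{h=1}^H r_i(s_h,a_h)\big]$. Fix weights $w_1\ge w_2\ge\dots\ge w_n\ge 0$ with $\sum_j w_j=1$. The generalized Gini welfare is $$\mathrm{GGW}(\pi;P)=\sum_{j=1}^n w_j V^\pi(r_{i_j};P),\qquad\text{where } V^\pi(r_{i_1};P)\le\dots\le V^\pi(r_{i_n};P).$$ **Algorithm (UCRL-GGW with parameter $\delta\in(0,1)$).**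 Before episode $t=1,2,\dots$ let $$N_t(s,a)=\sum_{t'<t}\sum_{h=1}^{H-1}\mathbf 1\{s_{t',h}=s,\,a_{t',h}=a\},\qquad N_t(s,a,s')=\sum_{t'<t}\sum_{h=1}^{H-1}\mathbf 1\{s_{t',h}=s,\,a_{t',h}=a,\,s_{t',h+1}=s'\},$$ let $\widehat P_t(s,a,s')=N_t(s,a,s')/N_t(s,a)$ if $N_t(s,a)>0$ and $\widehat P_t(s,a,s')=1/S$ otherwise, and let $C_t$ be the set of all transition functions $P$ such that for all $s,a$ $$\|P(s,a,\cdot)-\widehat P_t(s,a,\cdot)\|_1\le\sqrt{\frac{4S\log(SAt/\delta)}{\max\{1,N_t(s,a)\}}}.$$ The algorithm chooses $\widetilde P_t\in\mathrm{argmax}_{P\in C_t}\max_\pi\mathrm{GGW}(\pi;P)$ and $\widetilde\pi_t\in\mathrm{argmax}_\pi\mathrm{GGW}(\pi;\widetilde P_t)$ (ties are broken by an arbitrary function of the past episodes), and plays $\widetilde\pi_t$ for one episode in the MDP with transition function $P^\star$. **Theorem.** There is an absolute constant $C>0$ such that for every such instance (all $n,H,\mathcal S,\mathcal A,\rho,P^\star,r,w$),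 every $\delta\in(0,1)$, every tie-breaking rule and every number of episodes $T$, with probability at least $1-\delta$ $$\mathrm{Reg}_{\mathrm{GGW}}(T)=\sum_{t=1}^T\big(\mathrm{GGW}(\pi^\star;P^\star)-\mathrm{GGW}(\widetilde\pi_t;P^\star)\big)\le C\,H^2S\sqrt{AT}\,\log(SAT/\delta),$$ where $\pi^\star\in\mathrm{argmax}_\pi\mathrm{GGW}(\pi;P^\star)$. In particular $\mathrm{Reg}_{\mathrm{GGW}}(T)=\widetilde O(H^2S\sqrt{AT})$ with high probability, with no dependence on the number $n$ of agents. -/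

import Mathlib

namespace FairRL

/-- Transition functions: `(P s a).1 s'` is the probability of moving from `s` to `s'` under `a`. -/
abbrev Transition (S A : Type*) [Fintype S] := S → A → stdSimplex ℝ S

/-- Non-stationary policies over a horizon `H`: `(π h s).1 a` is the probability of playing `a`
in state `s` at step `h`. -/
abbrev Policy (H : ℕ) (S A : Type*) [Fintype A] := Fin H → S → stdSimplex ℝ A

/-- An episode: the pairs (state, action) at the steps `h = 0, …, H - 1`. -/
abbrev Episode (H : ℕ) (S A : Type*) := Fin H → S × A

/-- The histories consisting of `k` complete episodes. -/
abbrev History (k H : ℕ) (S A : Type*) := Fin k → Episode H S A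

section Model

variable {n H : ℕ} {S A : Type*} [Fintype S] [Fintype A]

/-- The probability of the episode `e` when the initial state is drawn from `ρ`, the transition
function is `P`, and the policy `π` is played. -/
noncomputable def episodeProb (ρ : stdSimplex ℝ S) (P : Transition S A) (π : Policy H S A)
    (e : Episode H S A) : ℝ :=
  ∏ h : Fin H,
    (if (h : ℕ) = 0 then ρ.1 (e h).1
      else (P (e ⟨(h : ℕ) - 1, by omega⟩).1 (e ⟨(h : ℕ) - 1, by omega⟩).2).1 (e h).1) *
    (π h (e h).1).1 (e h).2

/-- The value of `π` for the reward function `r` under `P`: the expected sum of rewards over the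
`H` steps of an episode. -/
noncomputable def value (ρ : stdSimplex ℝ S) (r : S → A → ℝ) (π : Policy H S A)
    (P : Transition S A) : ℝ :=
  ∑ e : Episode H S A, episodeProb ρ P π e * ∑ h : Fin H, r (e h).1 (e h).2

/-- The weighted sum of the entries of `v` sorted in non-decreasing order, so that the first weight
goes to the smallest entry. -/
noncomputable def gini (w v : Fin n → ℝ) : ℝ :=
  ∑ j : Fin n, w j * v (Tuple.sort v j)

/-- Generalized Gini welfare of the policy `π` under the transition function `P`. -/
noncomputable def ggw (ρ : stdSimplex ℝ S) (r : Fin n → S → A → ℝ) (w : Fin n → ℝ)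
    (π : Policy H S A) (P : Transition S A) : ℝ :=
  gini w (fun i => value ρ (r i) π P)

open Classical in
/-- The number of times `(s, a)` occurs in the history at a step other than the last one of its
episode, that is, at a step whose successor state is observed. -/
noncomputable def visits {k : ℕ} (τ : History k H S A) (s : S) (a : A) : ℕ :=
  ∑ i : Fin k, ∑ h : Fin H, if (h : ℕ) + 1 < H ∧ τ i h = (s, a) then 1 else 0

open Classical in
/-- The number of observed transitions from `(s, a)` to `s'` in the history. -/
noncomputable def transitions {k : ℕ} (τ : History k H S A) (s : S) (a : A) (s' : S) : ℕ :=
  ∑ i : Fin k, ∑ h : Fin H,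
    if ∃ hh : (h : ℕ) + 1 < H, τ i h = (s, a) ∧ (τ i ⟨(h : ℕ) + 1, hh⟩).1 = s' then 1 else 0

/-- The empirical transition function; it is uniform at a pair without observed transitions. -/
noncomputable def empirical {k : ℕ} (τ : History k H S A) (s : S) (a : A) (s' : S) : ℝ :=
  if visits τ s a = 0 then 1 / (Fintype.card S : ℝ)
  else (transitions τ s a s' : ℝ) / (visits τ s a : ℝ)

/-- The confidence set used in episode `t = k + 1`, built from the `k` preceding episodes:
`‖P(s,a,·) - P̂(s,a,·)‖₁ ≤ √(4 S log(S A t / δ) / max {1, N(s,a)})` for all `s` and `a`. -/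
def confidenceSet (δ : ℝ) {k : ℕ} (τ : History k H S A) : Set (Transition S A) :=
  {P | ∀ s a, ∑ s' : S, |(P s a).1 s' - empirical τ s a s'| ≤
    Real.sqrt (4 * (Fintype.card S : ℝ) *
      Real.log ((Fintype.card S : ℝ) * (Fintype.card A : ℝ) * ((k : ℝ) + 1) / δ) /
        max 1 (visits τ s a : ℝ))}

/-- A planning rule: for every history of complete episodes, the optimistic transition function and
the policy of the next episode. -/
abbrev Planner (H : ℕ) (S A : Type*) [Fintype S] [Fintype A] :=
  (k : ℕ) → History k H S A → Transition S A × Policy H S A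

/-- The algorithm UCRL-`F` with confidence parameter `δ` (and an arbitrary rule for breaking ties):
after each history `τ`, the model `P̃` maximizes `max_π F(π; P)` over the confidence set, and the
policy `π̃` maximizes `F(π; P̃)`. -/
def IsUCRL (F : Policy H S A → Transition S A → ℝ) (δ : ℝ) (alg : Planner H S A) : Prop :=
  ∀ (k : ℕ) (τ : History k H S A),
    (alg k τ).1 ∈ confidenceSet δ τ ∧
    (∀ P ∈ confidenceSet δ τ, ∀ π, F π P ≤ F (alg k τ).2 (alg k τ).1) ∧
    (∀ π, F π (alg k τ).1 ≤ F (alg k τ).2 (alg k τ).1)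

/-- The policy played in the episode with (zero-based) index `t`, as a function of the run `τ`; it
depends on the episodes before `t` only. -/
def playedPolicy (alg : Planner H S A) {T : ℕ} (τ : History T H S A) (t : Fin T) : Policy H S A :=
  (alg t (fun i : Fin (t : ℕ) => τ ⟨(i : ℕ), i.2.trans t.2⟩)).2

/-- The probability that the first `T` episodes of the interaction with the true transition
function `P` are `τ`. -/
noncomputable def runProb (ρ : stdSimplex ℝ S) (P : Transition S A) (alg : Planner H S A) {T : ℕ}
    (τ : History T H S A) : ℝ :=
  ∏ t : Fin T, episodeProb ρ P (playedPolicy alg τ t) (τ t)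

open Classical in
/-- The probability of the event `E` over the first `T` episodes. -/
noncomputable def runPr (ρ : stdSimplex ℝ S) (P : Transition S A) (alg : Planner H S A) {T : ℕ}
    (E : Set (History T H S A)) : ℝ :=
  ∑ τ : History T H S A, if τ ∈ E then runProb ρ P alg τ else 0

/-- The regret over `T` episodes against `πstar`, for the objective `F` evaluated under the true
transition function `P`. -/
noncomputable def regret (F : Policy H S A → Transition S A → ℝ) (P : Transition S A)
    (πstar : Policy H S A) (alg : Planner H S A) {T : ℕ} (τ : History T H S A) : ℝ :=
  ∑ t : Fin T, (F πstar P - F (playedPolicy alg τ t) P)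

end Model

end FairRL

/-! The proof is optimism plus three estimates. For non-increasing non-negative weights the sorted
order minimizes the weighted sum over all permutations, so with total weight one the Gini welfare is
monotone and 1-Lipschitz in the sup norm (`gini_le_gini_add`). This removes `n`: it suffices to
bound each value difference between the optimistic and the true model.

That difference is at most `H` times the expected sum, along an episode of the played policy in the
true model, of the `ℓ¹` distances of transition laws (`sum_abs_episodeProb_sub_le`). If the true
model is in the confidence set, these distances are at most `bonus`, so `H * expectedBonus` bounds
the regret of one episode.

Conditional expectations of bonuses are compared with observed bonuses by an exponential
supermartingale (`sum_expectedBonus_le`), and observed bonuses are summed by a pigeonhole argument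
with Cauchy–Schwarz (`sum_episodeBonus_le`).

The true model lies in the confidence sets by Hoeffding: the `ℓ¹` norm is a maximum over sign
vectors, and each choice of pair, signs and guessed visit count gives an exponential
supermartingale. There are up to `k * H` counts, while the radius has no `log H`; the union bound is
therefore used only for `k ≥ H`, and the first `H` episodes cost at most `H²`. All supermartingales
enter one weight of mean at most `δ`, and Markov's inequality concludes. The case of a single state
is separate: there is only one model and the regret is non-positive. -/

namespace FairRL

/-! ### Episode laws: normalization, supermartingales and comparison of models. -/

section Weights

variable {H : ℕ} {S A : Type*} [Fintype S] [Fintype A]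

theorem sum_snoc {X : Type*} [Fintype X] (m : ℕ) (f : (Fin (m + 1) → X) → ℝ) :
    ∑ e, f e = ∑ e : Fin m → X, ∑ y : X, f (Fin.snoc e y : Fin (m + 1) → X) := by
  rw [← (Fin.snocEquiv (fun _ : Fin (m + 1) => X)).sum_comp, Fintype.sum_prod_type,
    Finset.sum_comm]
  rfl

theorem episodeProb_nonneg (ρ : stdSimplex ℝ S) (P : Transition S A) (π : Policy H S A)
    (e : Episode H S A) : 0 ≤ episodeProb ρ P π e := by
  refine Finset.prod_nonneg fun h _ => mul_nonneg ?_ ((π h (e h).1).2.1 _)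
  split_ifs
  · exact ρ.2.1 _
  · exact (P _ _).2.1 _

/-- The Markov property. The extended horizon is `m + 2` because the first step draws from `ρ`
instead of `P`; inductions on the horizon therefore start at one. -/
theorem episodeProb_snoc {m : ℕ} (ρ : stdSimplex ℝ S) (P : Transition S A)
    (π : Policy (m + 2) S A) (e : Episode (m + 1) S A) (y : S × A) :
    episodeProb ρ P π (Fin.snoc e y : Fin (m + 2) → S × A) =
      episodeProb ρ P (fun h => π h.castSucc) e *
        ((P (e (Fin.last m)).1 (e (Fin.last m)).2).1 y.1 *
          (π (Fin.last (m + 1)) y.1).1 y.2) := by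
  unfold episodeProb
  rw [Fin.prod_univ_castSucc]
  congr 1
  · refine Finset.prod_congr rfl fun h _ => ?_
    have : ∀ hh, (Fin.snoc e y : Fin (m + 2) → S × A) ⟨(h.castSucc : ℕ) - 1, hh⟩ =
        e ⟨(h : ℕ) - 1, by omega⟩ := fun hh =>
      Fin.snoc_castSucc (α := fun _ => S × A) y e ⟨(h : ℕ) - 1, by omega⟩
    rw [this, Fin.snoc_castSucc]
    simp only [Fin.val_castSucc]
  · have : ∀ hh, (Fin.snoc e y : Fin (m + 2) → S × A) ⟨(Fin.last (m + 1) : ℕ) - 1, hh⟩ =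
        e (Fin.last m) := fun hh =>
      Fin.snoc_castSucc (α := fun _ => S × A) y e (Fin.last m)
    rw [this, Fin.snoc_last]
    simp

theorem sum_step (p : S → ℝ) (π : S → stdSimplex ℝ A) (g : S → ℝ) :
    ∑ y : S × A, p y.1 * (π y.1).1 y.2 * g y.1 = ∑ s, p s * g s := by
  rw [Fintype.sum_prod_type]
  refine Finset.sum_congr rfl fun s _ => ?_
  have h := (π s).2.2
  calc ∑ a, p s * (π s).1 a * g s = (∑ a, (π s).1 a) * (p s * g s) := by
        rw [Finset.sum_mul]; exact Finset.sum_congr rfl fun a _ => by ring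
    _ = _ := by rw [h, one_mul]

theorem sum_step_one (p : stdSimplex ℝ S) (π : S → stdSimplex ℝ A) :
    ∑ y : S × A, p.1 y.1 * (π y.1).1 y.2 = 1 := by
  have h := sum_step p.1 π (fun _ => 1)
  simp only [mul_one] at h
  rw [h]; exact p.2.2

theorem episodeProb_one (ρ : stdSimplex ℝ S) (P : Transition S A)
    (π : Policy 1 S A) (e : Episode 1 S A) :
    episodeProb ρ P π e = ρ.1 (e 0).1 * (π 0 (e 0).1).1 (e 0).2 := by
  simp [episodeProb]

theorem sum_episode_one (f : S × A → ℝ) : ∑ e : Episode 1 S A, f (e 0) = ∑ y, f y :=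
  (Equiv.funUnique (Fin 1) (S × A)).sum_comp f

/-- A multiplicative functional of the observed transitions whose one-step conditional means are
at most one has mean at most one over an episode. -/
theorem sum_episodeProb_mul_prod_le (ρ : stdSimplex ℝ S) (P : Transition S A)
    (φ : S × A → S → ℝ) (h0 : ∀ z s, 0 ≤ φ z s) (h1 : ∀ z, ∑ s, (P z.1 z.2).1 s * φ z s ≤ 1)
    (π : Policy H S A) :
    ∑ e : Episode H S A, episodeProb ρ P π e *
      ∏ h : Fin H, (if hh : (h : ℕ) + 1 < H then φ (e h) (e ⟨(h : ℕ) + 1, hh⟩).1 else 1) ≤ 1 := by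
  rcases H with _ | m
  · simp [episodeProb]
  induction m with
  | zero =>
    simp only [episodeProb_one]
    have h := sum_episode_one (fun y => ρ.1 y.1 * (π 0 y.1).1 y.2)
    rw [sum_step_one] at h
    exact (Finset.sum_congr rfl fun e _ => by simp).trans_le h.le
  | succ m ih =>
    refine le_trans ?_ (ih (fun h => π h.castSucc))
    rw [sum_snoc]
    refine Finset.sum_le_sum fun e _ => ?_
    have key : ∀ y : S × A, (∏ h : Fin (m + 2), (if hh : (h : ℕ) + 1 < m + 2 then
        φ ((Fin.snoc e y : Fin (m + 2) → S × A) h)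
          ((Fin.snoc e y : Fin (m + 2) → S × A) ⟨(h : ℕ) + 1, hh⟩).1 else 1)) =
        (∏ h : Fin (m + 1), (if hh : (h : ℕ) + 1 < m + 1 then
          φ (e h) (e ⟨(h : ℕ) + 1, hh⟩).1 else 1)) * φ (e (Fin.last m)) y.1 := by
      intro y
      rw [Fin.prod_univ_castSucc, Fin.prod_univ_castSucc, Fin.prod_univ_castSucc]
      have e1 : ∀ (i : Fin m) hh, (Fin.snoc e y : Fin (m + 2) → S × A)
          ⟨(i.castSucc.castSucc : ℕ) + 1, hh⟩ = e ⟨(i : ℕ) + 1, by omega⟩ := fun i hh =>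
        Fin.snoc_castSucc (α := fun _ => S × A) y e ⟨(i : ℕ) + 1, by omega⟩
      have e2 : ∀ hh, (Fin.snoc e y : Fin (m + 2) → S × A)
          ⟨((Fin.last m).castSucc : ℕ) + 1, hh⟩ = y := fun hh =>
        Fin.snoc_last (α := fun _ => S × A) y e
      simp only [e1, e2, Fin.snoc_castSucc]
      simp
    have hpr : 0 ≤ ∏ h : Fin (m + 1), (if hh : (h : ℕ) + 1 < m + 1 then
          φ (e h) (e ⟨(h : ℕ) + 1, hh⟩).1 else 1) :=
      Finset.prod_nonneg fun h _ => by split_ifs; exacts [h0 _ _, zero_le_one]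
    simp only [key, episodeProb_snoc]
    calc _ = episodeProb ρ P (fun h => π h.castSucc) e * (∏ h : Fin (m + 1),
          (if hh : (h : ℕ) + 1 < m + 1 then φ (e h) (e ⟨(h : ℕ) + 1, hh⟩).1 else 1)) *
          ∑ y : S × A, (P (e (Fin.last m)).1 (e (Fin.last m)).2).1 y.1 *
          (π (Fin.last (m + 1)) y.1).1 y.2 * φ (e (Fin.last m)) y.1 := by
          rw [Finset.mul_sum]; exact Finset.sum_congr rfl fun y _ => by ring
      _ ≤ _ := by
          rw [sum_step]
          exact mul_le_of_le_one_right (mul_nonneg (episodeProb_nonneg _ _ _ _) hpr) (h1 _)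

/-- Causality: the last step integrates to one, so a functional of the earlier steps does not see
it. -/
theorem sum_episodeProb_snoc {m : ℕ} (ρ : stdSimplex ℝ S) (P : Transition S A)
    (π : Policy (m + 2) S A) (f : Episode (m + 1) S A → ℝ) :
    ∑ e : Episode (m + 1) S A, ∑ y : S × A,
      episodeProb ρ P π (Fin.snoc e y : Fin (m + 2) → S × A) * f e =
      ∑ e : Episode (m + 1) S A, episodeProb ρ P (fun h => π h.castSucc) e * f e := by
  refine Finset.sum_congr rfl fun e _ => ?_
  rw [← Finset.sum_mul]
  simp only [episodeProb_snoc]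
  rw [← Finset.mul_sum, sum_step_one, mul_one]

theorem sum_episodeProb (ρ : stdSimplex ℝ S) (P : Transition S A) (π : Policy H S A) :
    ∑ e : Episode H S A, episodeProb ρ P π e = 1 := by
  rcases H with _ | m
  · simp [episodeProb]
  induction m with
  | zero =>
    simp only [episodeProb_one]
    rw [← sum_step_one ρ (π 0), ← sum_episode_one]
  | succ m ih =>
    rw [sum_snoc]
    simpa [ih] using sum_episodeProb_snoc ρ P π (fun _ => 1)

/-- The `ℓ¹` distance of the episode laws of two models is at most the expected sum of the `ℓ¹`
distances of the transition laws along an episode. -/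
theorem sum_abs_episodeProb_sub_le (ρ : stdSimplex ℝ S) (P Q : Transition S A)
    (π : Policy H S A) :
    ∑ e : Episode H S A, |episodeProb ρ Q π e - episodeProb ρ P π e| ≤
      ∑ e : Episode H S A, episodeProb ρ P π e * ∑ h : Fin H,
        if (h : ℕ) + 1 < H then
          ∑ s', |(Q (e h).1 (e h).2).1 s' - (P (e h).1 (e h).2).1 s'| else 0 := by
  set d : S × A → ℝ := fun z => ∑ s', |(Q z.1 z.2).1 s' - (P z.1 z.2).1 s'| with hd
  change _ ≤ ∑ e : Episode H S A, episodeProb ρ P π e * ∑ h : Fin H,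
        if (h : ℕ) + 1 < H then d (e h) else 0
  rcases H with _ | m
  · simp [episodeProb]
  induction m with
  | zero => simp [episodeProb_one]
  | succ m ih =>
    set p := episodeProb ρ P (fun h => π h.castSucc) with hp
    set q := episodeProb ρ Q (fun h => π h.castSucc) with hq
    have hR : ∑ e : Episode (m + 2) S A, episodeProb ρ P π e * ∑ h : Fin (m + 2),
        (if (h : ℕ) + 1 < m + 2 then d (e h) else 0) =
        ∑ e : Episode (m + 1) S A, p e * ∑ h : Fin (m + 1), d (e h) := by
      rw [sum_snoc, ← sum_episodeProb_snoc]
      refine Finset.sum_congr rfl fun e _ => Finset.sum_congr rfl fun y _ => ?_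
      rw [Fin.sum_univ_castSucc]
      simp only [Fin.val_castSucc, Fin.val_last, Fin.snoc_castSucc, lt_irrefl, if_false, add_zero]
      congr 1
      exact Finset.sum_congr rfl fun h _ => if_pos (by omega)
    have hS : ∀ e : Episode (m + 1) S A, ∑ h : Fin (m + 1), d (e h) =
        (∑ h : Fin (m + 1), if (h : ℕ) + 1 < m + 1 then d (e h) else 0) +
          d (e (Fin.last m)) := by
      intro e
      rw [Fin.sum_univ_castSucc, Fin.sum_univ_castSucc]
      simp
    rw [hR]
    simp only [hS, mul_add, Finset.sum_add_distrib]
    refine le_trans ?_ (add_le_add_left (ih _) _)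
    rw [sum_snoc, ← Finset.sum_add_distrib]
    refine Finset.sum_le_sum fun e _ => ?_
    simp only [episodeProb_snoc, ← hp, ← hq]
    set z := e (Fin.last m)
    set πl := π (Fin.last (m + 1))
    calc ∑ y : S × A, |q e * ((Q z.1 z.2).1 y.1 * (πl y.1).1 y.2) -
          p e * ((P z.1 z.2).1 y.1 * (πl y.1).1 y.2)|
        ≤ ∑ y : S × A, (|q e - p e| * ((Q z.1 z.2).1 y.1 * (πl y.1).1 y.2) +
          p e * (|(Q z.1 z.2).1 y.1 - (P z.1 z.2).1 y.1| * (πl y.1).1 y.2)) := by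
          refine Finset.sum_le_sum fun y _ => ?_
          have hy : 0 ≤ (πl y.1).1 y.2 := (πl y.1).2.1 _
          have hQ : 0 ≤ (Q z.1 z.2).1 y.1 := (Q z.1 z.2).2.1 _
          have hpe : 0 ≤ p e := episodeProb_nonneg _ _ _ _
          -- Hybrid splitting: the accumulated error is carried forward by `Q`, while the new error
          -- is weighted by `p`. Hence the final expectation is under `P` alone.
          rw [show q e * ((Q z.1 z.2).1 y.1 * (πl y.1).1 y.2) -
            p e * ((P z.1 z.2).1 y.1 * (πl y.1).1 y.2) =
            (q e - p e) * ((Q z.1 z.2).1 y.1 * (πl y.1).1 y.2) +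
            p e * (((Q z.1 z.2).1 y.1 - (P z.1 z.2).1 y.1) * (πl y.1).1 y.2) by ring]
          refine (abs_add_le _ _).trans (le_of_eq ?_)
          simp only [abs_mul, abs_of_nonneg hy, abs_of_nonneg hQ, abs_of_nonneg hpe]
      _ = |q e - p e| + p e * d z := by
          rw [Finset.sum_add_distrib, ← Finset.mul_sum, ← Finset.mul_sum, sum_step_one, mul_one]
          have := sum_step (fun s => |(Q z.1 z.2).1 s - (P z.1 z.2).1 s|) πl (fun _ => 1)
          simp only [mul_one] at this
          rw [this]

end Weights

/-! ### Laws of runs: supermartingales across episodes and Markov's inequality. -/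

section Runs

variable {H : ℕ} {S A : Type*} [Fintype S] [Fintype A]

/-- The first `k` episodes of a run. -/
def firstEpisodes {T : ℕ} (τ : History T H S A) (k : ℕ) (hk : k ≤ T) : History k H S A :=
  fun i => τ ⟨(i : ℕ), i.2.trans_le hk⟩

theorem runProb_nonneg (ρ : stdSimplex ℝ S) (P : Transition S A) (alg : Planner H S A) {T : ℕ}
    (τ : History T H S A) : 0 ≤ runProb ρ P alg τ :=
  Finset.prod_nonneg fun _ _ => episodeProb_nonneg _ _ _ _

theorem firstEpisodes_snoc {T : ℕ} (τ : History T H S A) (e : Episode H S A) (k : ℕ)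
    (hk : k ≤ T) : firstEpisodes (Fin.snoc τ e : Fin (T + 1) → Episode H S A) k (by omega) =
      firstEpisodes τ k hk := by
  funext i
  exact Fin.snoc_castSucc (α := fun _ => Episode H S A) e τ ⟨(i : ℕ), by omega⟩

theorem playedPolicy_eq (alg : Planner H S A) {T : ℕ} (τ : History T H S A) (t : Fin T) :
    playedPolicy alg τ t = (alg t (firstEpisodes τ t t.2.le)).2 := rfl

/-- Holds because the planner sees only completed episodes, so appending one leaves the earlier
policies unchanged. -/
theorem runProb_snoc (ρ : stdSimplex ℝ S) (P : Transition S A) (alg : Planner H S A) {T : ℕ}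
    (τ : History T H S A) (e : Episode H S A) :
    runProb ρ P alg (Fin.snoc τ e : Fin (T + 1) → Episode H S A) =
      runProb ρ P alg τ * episodeProb ρ P (alg T τ).2 e := by
  unfold runProb
  rw [Fin.prod_univ_castSucc]
  congr 1
  · refine Finset.prod_congr rfl fun t _ => ?_
    rw [Fin.snoc_castSucc, playedPolicy_eq, playedPolicy_eq]
    simp only [Fin.val_castSucc, firstEpisodes_snoc τ e t t.2.le]
  · rw [Fin.snoc_last, playedPolicy_eq]
    simp only [Fin.val_last, firstEpisodes_snoc τ e T le_rfl]
    rfl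

theorem sum_runProb (ρ : stdSimplex ℝ S) (P : Transition S A) (alg : Planner H S A) (T : ℕ) :
    ∑ τ : History T H S A, runProb ρ P alg τ = 1 := by
  induction T with
  | zero => simp [runProb]
  | succ T ih =>
    rw [sum_snoc]
    simp only [runProb_snoc, ← Finset.mul_sum, sum_episodeProb, mul_one, ih]

/-- Supermartingale principle: integrating out the last episode, given the past, can only decrease
the product. Both concentration arguments rest on it. -/
theorem sum_runProb_mul_prod_le (ρ : stdSimplex ℝ S) (P : Transition S A) (alg : Planner H S A)
    (G : (k : ℕ) → History k H S A → Episode H S A → ℝ) (h0 : ∀ k τ e, 0 ≤ G k τ e)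
    (h1 : ∀ k τ, ∑ e, episodeProb ρ P (alg k τ).2 e * G k τ e ≤ 1) (T : ℕ) :
    ∑ τ : History T H S A, runProb ρ P alg τ *
      ∏ t : Fin T, G t (firstEpisodes τ t t.2.le) (τ t) ≤ 1 := by
  induction T with
  | zero => simp [runProb]
  | succ T ih =>
    refine le_trans ?_ ih
    rw [sum_snoc]
    refine Finset.sum_le_sum fun τ _ => ?_
    have key : ∀ e : Episode H S A, (∏ t : Fin (T + 1), G t
        (firstEpisodes (Fin.snoc τ e : Fin (T + 1) → Episode H S A) t t.2.le)
        ((Fin.snoc τ e : Fin (T + 1) → Episode H S A) t)) =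
        (∏ t : Fin T, G t (firstEpisodes τ t t.2.le) (τ t)) * G T τ e := by
      intro e
      rw [Fin.prod_univ_castSucc]
      congr 1
      · refine Finset.prod_congr rfl fun t _ => ?_
        rw [Fin.snoc_castSucc]
        simp only [Fin.val_castSucc, firstEpisodes_snoc τ e t t.2.le]
      · rw [Fin.snoc_last]
        simp only [Fin.val_last, firstEpisodes_snoc τ e T le_rfl]
        rfl
    simp only [key, runProb_snoc]
    have hpr : 0 ≤ ∏ t : Fin T, G t (firstEpisodes τ t t.2.le) (τ t) :=
      Finset.prod_nonneg fun t _ => h0 _ _ _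
    calc _ = runProb ρ P alg τ * (∏ t : Fin T, G t (firstEpisodes τ t t.2.le) (τ t)) *
          ∑ e, episodeProb ρ P (alg T τ).2 e * G T τ e := by
          rw [Finset.mul_sum]; exact Finset.sum_congr rfl fun y _ => by ring
      _ ≤ _ := mul_le_of_le_one_right (mul_nonneg (runProb_nonneg _ _ _ _) hpr) (h1 _ _)

/-- Markov's inequality; with `W` a sum of non-negative terms it also performs the union bound. -/
theorem one_sub_le_runPr (ρ : stdSimplex ℝ S) (P : Transition S A) (alg : Planner H S A) {T : ℕ}
    (E : Set (History T H S A)) (W : History T H S A → ℝ) (h0 : ∀ τ, 0 ≤ W τ)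
    (h1 : ∀ τ, τ ∉ E → 1 ≤ W τ) :
    1 - ∑ τ, runProb ρ P alg τ * W τ ≤ runPr ρ P alg E := by
  classical
  rw [← sum_runProb ρ P alg T, runPr, ← Finset.sum_sub_distrib]
  refine Finset.sum_le_sum fun τ _ => ?_
  have hp := runProb_nonneg ρ P alg τ
  split_ifs with h
  · nlinarith [h0 τ]
  · nlinarith [h1 τ h]

end Runs

/-! ### Stability of the welfare and of values under a change of model. -/

section Welfare

variable {n H : ℕ} {S A : Type*} [Fintype S] [Fintype A]

theorem gini_le_gini_add {w : Fin n → ℝ} (h0 : ∀ j, 0 ≤ w j) (hw : Antitone w)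
    (h1 : ∑ j, w j = 1) {v v' : Fin n → ℝ} {c : ℝ} (h : ∀ i, v i ≤ v' i + c) :
    gini w v ≤ gini w v' + c := by
  have hanti : Antivary w (v ∘ Tuple.sort v) :=
    Antitone.antivary hw (Tuple.monotone_sort v)
  -- Rearrangement inequality: replacing the sorting permutation of `v` by that of `v'` can only
  -- increase the weighted sum, after which the two vectors are compared entry by entry.
  have key := hanti.sum_mul_le_sum_mul_comp_perm
    (σ := Equiv.trans (Tuple.sort v') (Tuple.sort v).symm)
  simp only [Function.comp, Equiv.trans_apply, Equiv.apply_symm_apply] at key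
  calc gini w v ≤ ∑ j, w j * v (Tuple.sort v' j) := key
    _ ≤ ∑ j, (w j * v' (Tuple.sort v' j) + w j * c) := by
        refine Finset.sum_le_sum fun j _ => ?_
        rw [← mul_add]
        exact mul_le_mul_of_nonneg_left (h _) (h0 j)
    _ = gini w v' + c := by rw [Finset.sum_add_distrib, ← Finset.sum_mul, h1, one_mul]; rfl

theorem sum_reward_mem {r : S → A → ℝ} (hr : ∀ s a, r s a ∈ Set.Icc (0 : ℝ) 1)
    (e : Episode H S A) : ∑ h : Fin H, r (e h).1 (e h).2 ∈ Set.Icc (0 : ℝ) H := by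
  refine ⟨Finset.sum_nonneg fun h _ => (hr _ _).1, ?_⟩
  calc _ ≤ ∑ _h : Fin H, (1 : ℝ) := Finset.sum_le_sum fun h _ => (hr _ _).2
    _ = H := by simp

theorem value_mem (ρ : stdSimplex ℝ S) {r : S → A → ℝ} (hr : ∀ s a, r s a ∈ Set.Icc (0 : ℝ) 1)
    (π : Policy H S A) (P : Transition S A) : value ρ r π P ∈ Set.Icc (0 : ℝ) H := by
  refine ⟨Finset.sum_nonneg fun e _ => mul_nonneg (episodeProb_nonneg _ _ _ _)
    (sum_reward_mem hr e).1, ?_⟩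
  calc value ρ r π P ≤ ∑ e : Episode H S A, episodeProb ρ P π e * H :=
        Finset.sum_le_sum fun e _ =>
          mul_le_mul_of_nonneg_left (sum_reward_mem hr e).2 (episodeProb_nonneg _ _ _ _)
    _ = H := by rw [← Finset.sum_mul, sum_episodeProb, one_mul]

theorem value_le_value_add (ρ : stdSimplex ℝ S) {r : S → A → ℝ}
    (hr : ∀ s a, r s a ∈ Set.Icc (0 : ℝ) 1) (π : Policy H S A) (P Q : Transition S A) :
    value ρ r π Q ≤ value ρ r π P + H * ∑ e : Episode H S A, episodeProb ρ P π e * ∑ h : Fin H,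
        if (h : ℕ) + 1 < H then
          ∑ s', |(Q (e h).1 (e h).2).1 s' - (P (e h).1 (e h).2).1 s'| else 0 := by
  have h1 : value ρ r π Q - value ρ r π P ≤
      ∑ e : Episode H S A, H * |episodeProb ρ Q π e - episodeProb ρ P π e| := by
    unfold value
    rw [← Finset.sum_sub_distrib]
    refine Finset.sum_le_sum fun e _ => ?_
    obtain ⟨ha, hb⟩ := sum_reward_mem hr e
    rw [← sub_mul, mul_comm]
    calc _ ≤ (∑ h : Fin H, r (e h).1 (e h).2) * |episodeProb ρ Q π e - episodeProb ρ P π e| :=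
          mul_le_mul_of_nonneg_left (le_abs_self _) ha
      _ ≤ _ := mul_le_mul_of_nonneg_right hb (abs_nonneg _)
  rw [← Finset.mul_sum] at h1
  have h2 := mul_le_mul_of_nonneg_left (sum_abs_episodeProb_sub_le ρ P Q π)
    (Nat.cast_nonneg (α := ℝ) H)
  linarith

end Welfare

end FairRL

namespace FairRL

/-! ### Concentration of the empirical transition function. -/

section Concentration

variable {H : ℕ} {S A : Type*} [Fintype S] [Fintype A]

/-- Hoeffding's lemma for a distribution on a finite set and a function with values in `[-1, 1]`. -/
theorem sum_mul_exp_le (p : stdSimplex ℝ S) (x : S → ℝ) (hx : ∀ s, x s ∈ Set.Icc (-1 : ℝ) 1)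
    (l : ℝ) : ∑ s, p.1 s * Real.exp (l * (x s - ∑ s', p.1 s' * x s')) ≤ Real.exp (l ^ 2 / 2) := by
  let _ : MeasurableSpace S := ⊤
  have hp : ∑ s, ENNReal.ofReal (p.1 s) = 1 := by
    rw [← ENNReal.ofReal_sum_of_nonneg fun s _ => p.2.1 s, p.2.2, ENNReal.ofReal_one]
  set q := PMF.ofFintype _ hp with hq
  have hint : ∀ f : S → ℝ, ∫ s, f s ∂q.toMeasure = ∑ s, p.1 s * f s := by
    intro f
    rw [PMF.integral_eq_sum]
    exact Finset.sum_congr rfl fun s _ => by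
      rw [hq, PMF.ofFintype_apply, ENNReal.toReal_ofReal (p.2.1 s), smul_eq_mul]
  have h := (ProbabilityTheory.hasSubgaussianMGF_of_mem_Icc (μ := q.toMeasure) (X := x)
    (a := -1) (b := 1) (measurable_from_top.aemeasurable) (.of_forall hx)).mgf_le l
  rw [ProbabilityTheory.mgf, hint, hint] at h
  refine h.trans (le_of_eq ?_)
  norm_num

theorem sum_mul_transitions {k : ℕ} (τ : History k H S A) (s : S) (a : A) (f : S → ℝ) :
    ∑ s', f s' * (transitions τ s a s' : ℝ) = ∑ i : Fin k, ∑ h : Fin H,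
      open Classical in
      if hh : (h : ℕ) + 1 < H then
        (if τ i h = (s, a) then f (τ i ⟨(h : ℕ) + 1, hh⟩).1 else 0) else 0 := by
  classical
  simp only [transitions, Nat.cast_sum, Finset.mul_sum]
  rw [Finset.sum_comm]
  refine Finset.sum_congr rfl fun i _ => ?_
  rw [Finset.sum_comm]
  refine Finset.sum_congr rfl fun h _ => ?_
  by_cases hh : (h : ℕ) + 1 < H
  · by_cases hz : τ i h = (s, a)
    · simp [hh, hz]
    · simp [hz]
  · simp [hh]

theorem sum_transitions {k : ℕ} (τ : History k H S A) (s : S) (a : A) :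
    ∑ s', (transitions τ s a s' : ℝ) = visits τ s a := by
  classical
  have h := sum_mul_transitions τ s a (fun _ => 1)
  simp only [one_mul] at h
  rw [h, visits]
  push_cast
  refine Finset.sum_congr rfl fun i _ => Finset.sum_congr rfl fun h _ => ?_
  by_cases hh : (h : ℕ) + 1 < H <;> simp [hh]

theorem visits_le {k : ℕ} (τ : History k H S A) (s : S) (a : A) : visits τ s a ≤ k * H := by
  classical
  calc visits τ s a ≤ ∑ _i : Fin k, ∑ _h : Fin H, 1 :=
        Finset.sum_le_sum fun i _ => Finset.sum_le_sum fun h _ => by split_ifs <;> simp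
    _ = k * H := by simp

/-- The exponential of a functional of the transitions observed from `(s, a)` whose one-step mean
is at most one has mean at most one. -/
theorem sum_runProb_mul_exp_transitions_le (ρ : stdSimplex ℝ S) (P : Transition S A)
    (alg : Planner H S A) (s : S) (a : A) (f : S → ℝ)
    (hf : ∑ s', (P s a).1 s' * Real.exp (f s') ≤ 1) {k T : ℕ} (hk : k ≤ T) :
    ∑ τ : History T H S A, runProb ρ P alg τ *
      Real.exp (∑ s', f s' * (transitions (firstEpisodes τ k hk) s a s' : ℝ)) ≤ 1 := by
  classical
  set φ : S × A → S → ℝ := fun z s' => if z = (s, a) then Real.exp (f s') else 1 with hφ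
  set g : Episode H S A → ℝ := fun e =>
    ∏ h : Fin H, (if hh : (h : ℕ) + 1 < H then φ (e h) (e ⟨(h : ℕ) + 1, hh⟩).1 else 1) with hg
  have hφ0 : ∀ z s', 0 ≤ φ z s' := fun z s' => by
    simp only [hφ]; split_ifs <;> positivity
  have hφ1 : ∀ z, ∑ s', (P z.1 z.2).1 s' * φ z s' ≤ 1 := fun z => by
    by_cases hz : z = (s, a)
    · simpa [hφ, hz] using hf
    · simpa [hφ, hz] using (P z.1 z.2).2.2.le
  have hg0 : ∀ e, 0 ≤ g e := fun e =>
    Finset.prod_nonneg fun h _ => by split_ifs; exacts [hφ0 _ _, zero_le_one]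
  have hG := sum_runProb_mul_prod_le ρ P alg (fun i _ e => if i < k then g e else 1)
    (fun i _ e => by split_ifs; exacts [hg0 e, zero_le_one])
    (fun i τ => by
      by_cases hi : i < k
      · simp only [hi, if_true]
        exact sum_episodeProb_mul_prod_le ρ P φ hφ0 hφ1 _
      · simp only [hi, if_false, mul_one]
        exact (sum_episodeProb _ _ _).le) T
  refine le_trans (le_of_eq (Finset.sum_congr rfl fun τ _ => ?_)) hG
  congr 1
  rw [sum_mul_transitions, Real.exp_sum]
  obtain ⟨m, rfl⟩ := Nat.exists_eq_add_of_le hk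
  rw [Fin.prod_univ_add]
  simp only [Fin.val_castAdd, Fin.is_lt, if_true, Fin.val_natAdd, add_lt_iff_neg_left,
    Nat.not_lt_zero, if_false, Finset.prod_const_one, mul_one]
  refine Finset.prod_congr rfl fun i _ => ?_
  rw [hg, Real.exp_sum]
  refine Finset.prod_congr rfl fun h _ => ?_
  change Real.exp (if hh : (h : ℕ) + 1 < H then (if τ (Fin.castAdd m i) h = (s, a) then
    f (τ (Fin.castAdd m i) ⟨(h : ℕ) + 1, hh⟩).1 else 0) else 0) = _
  by_cases hh : (h : ℕ) + 1 < H
  · simp only [hh, dite_true, hφ]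
    split_ifs <;> simp
  · simp [hh]

/-- The value `±1` of a Boolean. -/
def boolSign (b : Bool) : ℝ := if b then 1 else -1

theorem boolSign_mem (b : Bool) : boolSign b ∈ Set.Icc (-1 : ℝ) 1 := by
  cases b <;> norm_num [boolSign]

/-- The increments of the logarithm of the exponential supermartingale for the deviation of the
empirical mean of the signs `x` from its mean under `p`. -/
noncomputable def devExponent (p : stdSimplex ℝ S) (l : ℝ) (x : S → Bool) (s' : S) : ℝ :=
  l * (boolSign (x s') - ∑ s'', p.1 s'' * boolSign (x s'')) - l ^ 2 / 2

/-- The compensator `l ^ 2 / 2` is exactly Hoeffding's bound for signs. -/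
theorem sum_mul_exp_devExponent_le (p : stdSimplex ℝ S) (l : ℝ) (x : S → Bool) :
    ∑ s', p.1 s' * Real.exp (devExponent p l x s') ≤ 1 := by
  have h := sum_mul_exp_le p (fun s => boolSign (x s)) (fun s => boolSign_mem _) l
  simp only [devExponent, sub_eq_add_neg _ (l ^ 2 / 2), Real.exp_add, ← mul_assoc,
    ← Finset.sum_mul]
  calc _ ≤ Real.exp (l ^ 2 / 2) * Real.exp (-(l ^ 2 / 2)) :=
        mul_le_mul_of_nonneg_right h (Real.exp_pos _).le
    _ = 1 := by rw [← Real.exp_add]; simp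

/-- The logarithmic factor of the confidence radius after `k` episodes. -/
noncomputable def logFactor (S A : Type*) [Fintype S] [Fintype A] (δ : ℝ) (k : ℕ) : ℝ :=
  Real.log ((Fintype.card S : ℝ) * (Fintype.card A : ℝ) * ((k : ℝ) + 1) / δ)

theorem sum_abs_sub_le_two (p q : stdSimplex ℝ S) : ∑ s, |p.1 s - q.1 s| ≤ 2 := by
  calc ∑ s, |p.1 s - q.1 s| ≤ ∑ s, (p.1 s + q.1 s) := Finset.sum_le_sum fun s _ => by
        rw [abs_le]; constructor <;> linarith [p.2.1 s, q.2.1 s]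
    _ = 2 := by rw [Finset.sum_add_distrib, p.2.2, q.2.2]; norm_num

/-- Keeps the logarithms at least `1 / 2`, so that they can absorb constants even when `δ` is near
one. -/
theorem two_le_of_card [Nonempty A] (hS : 2 ≤ Fintype.card S) {δ : ℝ} (h0 : 0 < δ) (h1 : δ < 1)
    {t : ℝ} (ht : 1 ≤ t) : 2 ≤ (Fintype.card S : ℝ) * (Fintype.card A : ℝ) * t / δ := by
  have hS' : (2 : ℝ) ≤ Fintype.card S := by exact_mod_cast hS
  have hA' : (1 : ℝ) ≤ Fintype.card A := by exact_mod_cast Fintype.card_pos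
  rw [le_div_iff₀ h0]
  have h2 : 2 ≤ (Fintype.card S : ℝ) * (Fintype.card A : ℝ) := by nlinarith
  nlinarith

theorem half_le_log {q : ℝ} (hq : 2 ≤ q) : 1 / 2 ≤ Real.log q := by
  have := Real.log_two_gt_d9
  have := Real.log_le_log (by norm_num) hq
  linarith

/-- If the model is outside the confidence set, then one of the exponential supermartingales is
large. -/
theorem exists_le_exp_of_notMem_confidenceSet [Nonempty A] (hS : 2 ≤ Fintype.card S) {δ : ℝ}
    (h0 : 0 < δ) (h1 : δ < 1) (P : Transition S A) {k : ℕ} (τ : History k H S A)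
    (hP : P ∉ confidenceSet δ τ) :
    ∃ s a, ∃ x : S → Bool, ∃ n ∈ Finset.Icc 1 (k * H),
      1 ≤ Real.exp (-(2 * Fintype.card S * logFactor S A δ k)) *
        Real.exp (∑ s', devExponent (P s a)
          (Real.sqrt (4 * Fintype.card S * logFactor S A δ k / n)) x s' *
            (transitions τ s a s' : ℝ)) := by
  have hL : 1 / 2 ≤ logFactor S A δ k := half_le_log
    (two_le_of_card hS h0 h1 (by linarith [Nat.cast_nonneg (α := ℝ) k]))
  have hS' : (2 : ℝ) ≤ Fintype.card S := by exact_mod_cast hS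
  set L := logFactor S A δ k with hLdef
  have hSL : 4 ≤ 4 * (Fintype.card S : ℝ) * L := by nlinarith
  simp only [confidenceSet, Set.mem_ofPred_eq, not_forall, not_le] at hP
  obtain ⟨s, a, hsa⟩ := hP
  change Real.sqrt (4 * (Fintype.card S : ℝ) * L / _) < _ at hsa
  -- At an unvisited pair the radius is at least 2, which no two distributions can exceed.
  have hN : visits τ s a ≠ 0 := by
    intro hN
    have hemp : (fun s' => empirical τ s a s') ∈ stdSimplex ℝ S := by
      refine ⟨fun s' => ?_, ?_⟩
      · simp only [empirical, hN, if_true]; positivity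
      · simp only [empirical, hN, if_true, Finset.sum_const, Finset.card_univ, nsmul_eq_mul]
        field_simp
    have h2 := sum_abs_sub_le_two (P s a) ⟨_, hemp⟩
    have h3 : 2 ≤ Real.sqrt (4 * (Fintype.card S : ℝ) * L / max 1 (visits τ s a : ℝ)) := by
      rw [hN]
      refine Real.le_sqrt_of_sq_le ?_
      simp only [Nat.cast_zero, zero_le_one, sup_of_le_left, div_one]
      linarith
    simp only at h2
    linarith
  have hn1 : 1 ≤ visits τ s a := Nat.one_le_iff_ne_zero.2 hN
  have hn1' : (1 : ℝ) ≤ visits τ s a := by exact_mod_cast hn1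
  set n := visits τ s a with hn
  rw [max_eq_right hn1'] at hsa
  set l := Real.sqrt (4 * (Fintype.card S : ℝ) * L / n) with hl
  have hl2 : l ^ 2 * n = 4 * Fintype.card S * L := by
    rw [hl, Real.sq_sqrt (by positivity)]
    field_simp
  have hl0 : 0 ≤ l := Real.sqrt_nonneg _
  -- The signs that turn the `ℓ¹` deviation into a linear functional of the counts.
  set x : S → Bool := fun s' => decide ((P s a).1 s' ≤ empirical τ s a s') with hx
  have hxs : ∀ s', boolSign (x s') * ((transitions τ s a s' : ℝ) - n * (P s a).1 s') =
      n * |(P s a).1 s' - empirical τ s a s'| := by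
    intro s'
    have : (transitions τ s a s' : ℝ) = n * empirical τ s a s' := by
      simp only [empirical, ← hn, hN, if_false]
      field_simp
    rw [this]
    by_cases hc : (P s a).1 s' ≤ empirical τ s a s'
    · simp only [hx, hc, decide_true, boolSign, if_true]
      rw [abs_of_nonpos (by linarith)]; ring
    · simp only [hx, hc, decide_false, boolSign]
      rw [abs_of_pos (by linarith)]; simp; ring
  refine ⟨s, a, x, n, Finset.mem_Icc.2 ⟨hn1, visits_le τ s a⟩, ?_⟩
  rw [← Real.exp_add, Real.one_le_exp_iff]
  have hsum : ∑ s', devExponent (P s a) l x s' * (transitions τ s a s' : ℝ) =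
      l * (n * ∑ s', |(P s a).1 s' - empirical τ s a s'|) - n * (l ^ 2 / 2) := by
    rw [Finset.mul_sum, Finset.sum_congr rfl fun s' _ => (hxs s').symm]
    set B := ∑ s', (P s a).1 s' * boolSign (x s') with hB
    have e1 : ∑ s', devExponent (P s a) l x s' * (transitions τ s a s' : ℝ) =
        l * ∑ s', boolSign (x s') * (transitions τ s a s' : ℝ) - (l * B + l ^ 2 / 2) * n := by
      rw [hn, ← sum_transitions, Finset.mul_sum, Finset.mul_sum, ← Finset.sum_sub_distrib]
      exact Finset.sum_congr rfl fun s' _ => by rw [devExponent, ← hB]; ring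
    have e2 : ∑ s', boolSign (x s') * ((transitions τ s a s' : ℝ) - n * (P s a).1 s') =
        ∑ s', boolSign (x s') * (transitions τ s a s' : ℝ) - n * B := by
      rw [hB, Finset.mul_sum, ← Finset.sum_sub_distrib]
      exact Finset.sum_congr rfl fun s' _ => by ring
    rw [e1, e2]
    ring
  rw [hsum]
  -- The deviation exceeds `l`, so the exponent is at least `n * l ^ 2 / 2`, that is, `2 * card S *
  -- L`.
  have := mul_le_mul_of_nonneg_left (mul_le_mul_of_nonneg_left hsa.le
    (Nat.cast_nonneg (α := ℝ) n)) hl0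
  nlinarith

/-- The price of the union over pairs, signs and counts. `H ≤ k` gives `k * H ≤ k ^ 2`, which the
fourth power of `k + 1` from the exponential absorbs; the result telescopes in `k`. -/
theorem confidence_weight_le [Nonempty A] (hS : 2 ≤ Fintype.card S) {δ : ℝ}
    (h0 : 0 < δ) (h1 : δ < 1) {k : ℕ} (hH : 1 ≤ H) (hk : H ≤ k) :
    (Fintype.card S : ℝ) * (Fintype.card A * (2 ^ Fintype.card S * ((k * H : ℕ) *
      Real.exp (-(2 * Fintype.card S * logFactor S A δ k))))) ≤
      δ / 2 * (1 / (k : ℝ) - 1 / ((k : ℝ) + 1)) := by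
  have hk1 : (1 : ℝ) ≤ k := by exact_mod_cast hH.trans hk
  have hkH : ((k * H : ℕ) : ℝ) ≤ k * k := by exact_mod_cast Nat.mul_le_mul_left k hk
  have hS' : (2 : ℝ) ≤ Fintype.card S := by exact_mod_cast hS
  have hA' : (1 : ℝ) ≤ Fintype.card A := by exact_mod_cast Fintype.card_pos
  have hq := two_le_of_card (A := A) hS h0 h1 (t := (k : ℝ) + 1) (by linarith)
  set q := (Fintype.card S : ℝ) * (Fintype.card A : ℝ) * ((k : ℝ) + 1) / δ with hqdef
  set m := (Fintype.card S : ℝ) * (Fintype.card A : ℝ) with hm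
  have hm2 : 2 ≤ m := by nlinarith
  have hexp : (2 : ℝ) ^ Fintype.card S * Real.exp (-(2 * Fintype.card S * logFactor S A δ k)) =
      (2 / q ^ 2) ^ Fintype.card S := by
    have : Real.exp (2 * Fintype.card S * logFactor S A δ k) = (q ^ 2) ^ Fintype.card S := by
      rw [mul_comm (2 : ℝ), mul_assoc, Real.exp_nat_mul, two_mul, Real.exp_add,
        show logFactor S A δ k = Real.log q from rfl, Real.exp_log (by linarith), ← pow_two]
    rw [Real.exp_neg, this, div_pow (2 : ℝ) (q ^ 2), div_eq_mul_inv]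
  -- Two states are needed here: with one state only `q ^ 2` would be gained, too little for
  -- summability.
  have hpow : (2 / q ^ 2) ^ Fintype.card S ≤ (2 / q ^ 2) ^ 2 :=
    pow_le_pow_of_le_one (by positivity) (by rw [div_le_one (by positivity)]; nlinarith) hS
  have hq2 : (2 / q ^ 2) ^ 2 = 4 * δ ^ 4 / (m ^ 4 * ((k : ℝ) + 1) ^ 4) := by
    rw [hqdef]; field_simp; ring
  calc _ = m * (k * H : ℕ) * ((2 : ℝ) ^ Fintype.card S *
        Real.exp (-(2 * Fintype.card S * logFactor S A δ k))) := by rw [hm]; ring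
    _ ≤ m * (k * k) * (4 * δ ^ 4 / (m ^ 4 * ((k : ℝ) + 1) ^ 4)) := by
        rw [hexp, ← hq2]; gcongr
    _ ≤ m * (k * (k + 1)) * (4 * δ / (m * 2 ^ 3 * (k ^ 2 * ((k : ℝ) + 1) ^ 2))) := by
        have hd : δ ^ 4 ≤ δ := by
          simpa using pow_le_pow_of_le_one h0.le h1.le (show 1 ≤ 4 by norm_num)
        have hm4 : m * 2 ^ 3 ≤ m ^ 4 := by
          rw [show m ^ 4 = m * m ^ 3 by ring]; gcongr
        have hk4 : (k : ℝ) ^ 2 * ((k : ℝ) + 1) ^ 2 ≤ ((k : ℝ) + 1) ^ 4 := by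
          rw [show ((k : ℝ) + 1) ^ 4 = ((k : ℝ) + 1) ^ 2 * ((k : ℝ) + 1) ^ 2 by ring]
          gcongr; linarith
        gcongr
        linarith
    _ = _ := by field_simp; ring

end Concentration

end FairRL

namespace FairRL

/-! ### Sums of observed and expected bonuses. -/

section Bonus

variable {H : ℕ} {S A : Type*} [Fintype S] [Fintype A]

/-- An upper bound for the `ℓ¹` distance between two models in the confidence set at a pair that
has been visited `N` times. -/
noncomputable def bonus (M : ℝ) (N : ℕ) : ℝ := min 2 (2 * Real.sqrt (M / max 1 (N : ℝ)))

theorem bonus_nonneg (M : ℝ) (N : ℕ) : 0 ≤ bonus M N := le_min (by norm_num) (by positivity)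

theorem bonus_le_two (M : ℝ) (N : ℕ) : bonus M N ≤ 2 := min_le_left _ _

/-- When the count at most doubles, the stale rate `m / √N` is comparable to the increment of the
square root, and so telescopes. -/
theorem mul_bonus_le {M : ℝ} (N m : ℕ) (hN : 1 ≤ N) (hm : m ≤ N) :
    m * bonus M N ≤ 8 * Real.sqrt M * (Real.sqrt ((N + m : ℕ) : ℝ) - Real.sqrt N) := by
  have hN' : (1 : ℝ) ≤ N := by exact_mod_cast hN
  have hm' : (m : ℝ) ≤ N := by exact_mod_cast hm
  have h1 : bonus M N ≤ 2 * (Real.sqrt M / Real.sqrt N) := by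
    rw [← Real.sqrt_div' _ (by positivity), bonus, max_eq_right hN']
    exact min_le_right _ _
  set x := Real.sqrt N with hx
  set y := Real.sqrt ((N + m : ℕ) : ℝ) with hy
  have hx0 : 0 < x := Real.sqrt_pos.2 (by linarith)
  have hx2 : x ^ 2 = N := Real.sq_sqrt (by linarith)
  have hy2 : y ^ 2 = N + m := by rw [hy, Real.sq_sqrt (by positivity)]; push_cast; ring
  have hxy : x ≤ y := Real.sqrt_le_sqrt (by push_cast; linarith [Nat.cast_nonneg (α := ℝ) m])
  have hy3 : y ≤ 3 * x := by nlinarith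
  have hkey : (m : ℝ) / x ≤ 4 * (y - x) := by
    rw [div_le_iff₀ hx0]
    nlinarith
  calc m * bonus M N ≤ m * (2 * (Real.sqrt M / x)) := by gcongr
    _ = 2 * Real.sqrt M * (m / x) := by ring
    _ ≤ 2 * Real.sqrt M * (4 * (y - x)) := by gcongr
    _ = _ := by ring

/-- The sum of the bonuses at a pair visited `m t ≤ H` times in the rounds `t`, where the bonus is
updated after each round. -/
theorem sum_mul_bonus_le {M : ℝ} (m : ℕ → ℕ) (hm : ∀ t, m t ≤ H) (T : ℕ) :
    ∑ t ∈ Finset.range T, (m t : ℝ) * bonus M (∑ i ∈ Finset.range t, m i) ≤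
      4 * H + 8 * Real.sqrt M * Real.sqrt ((∑ i ∈ Finset.range T, m i : ℕ) : ℝ) := by
  -- The truncated count is a potential: while fewer than `H` visits are recorded, doubling may
  -- fail, but the count stays below the cap `2 * H` and pays for the trivial bonus 2.
  have key : ∑ t ∈ Finset.range T, (m t : ℝ) * bonus M (∑ i ∈ Finset.range t, m i) ≤
      2 * (min (∑ i ∈ Finset.range T, m i) (2 * H) : ℕ) +
        8 * Real.sqrt M * Real.sqrt ((∑ i ∈ Finset.range T, m i : ℕ) : ℝ) := by
    induction T with
    | zero => simp
    | succ T ih =>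
      rw [Finset.sum_range_succ, Finset.sum_range_succ m]
      set N := ∑ i ∈ Finset.range T, m i
      have hmono : Real.sqrt N ≤ Real.sqrt ((N + m T : ℕ) : ℝ) :=
        Real.sqrt_le_sqrt (by exact_mod_cast Nat.le_add_right _ _)
      by_cases hN : H ≤ N ∧ 1 ≤ N
      · have h1 := mul_bonus_le (M := M) N (m T) hN.2 ((hm T).trans hN.1)
        have h2 : ((min N (2 * H) : ℕ) : ℝ) ≤ (min (N + m T) (2 * H) : ℕ) := by
          exact_mod_cast min_le_min_right _ (Nat.le_add_right _ _)
        linarith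
      · have h1 : (m T : ℝ) * bonus M N ≤ m T * 2 := by
          gcongr; exact bonus_le_two _ _
        have h2 : (min (N + m T) (2 * H) : ℕ) = min N (2 * H) + m T := by
          have := hm T
          omega
        have h3 := mul_le_mul_of_nonneg_left hmono
          (show 0 ≤ 8 * Real.sqrt M by positivity)
        rw [h2]
        push_cast at *
        linarith
  refine key.trans (add_le_add_left ?_ _)
  have : ((min (∑ i ∈ Finset.range T, m i) (2 * H) : ℕ) : ℝ) ≤ (2 * H : ℕ) := by
    exact_mod_cast min_le_right _ _
  push_cast at *
  linarith

/-- The sum of the bonuses along an episode. -/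
noncomputable def episodeBonus (M : ℝ) {k : ℕ} (τ : History k H S A) (e : Episode H S A) : ℝ :=
  ∑ h : Fin H, if (h : ℕ) + 1 < H then bonus M (visits τ (e h).1 (e h).2) else 0

theorem episodeBonus_nonneg (M : ℝ) {k : ℕ} (τ : History k H S A) (e : Episode H S A) :
    0 ≤ episodeBonus M τ e :=
  Finset.sum_nonneg fun h _ => by split_ifs; exacts [bonus_nonneg _ _, le_rfl]

theorem episodeBonus_le (M : ℝ) {k : ℕ} (τ : History k H S A) (e : Episode H S A) :
    episodeBonus M τ e ≤ 2 * H := by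
  calc _ ≤ ∑ _h : Fin H, (2 : ℝ) := Finset.sum_le_sum fun h _ => by
        split_ifs; exacts [bonus_le_two _ _, by norm_num]
    _ = 2 * H := by simp [mul_comm]

open Classical in
/-- The number of observed transitions from `(s, a)` in an episode. -/
noncomputable def episodeVisits (e : Episode H S A) (s : S) (a : A) : ℕ :=
  ∑ h : Fin H, if (h : ℕ) + 1 < H ∧ e h = (s, a) then 1 else 0

theorem episodeVisits_le (e : Episode H S A) (s : S) (a : A) : episodeVisits e s a ≤ H := by
  classical
  calc episodeVisits e s a ≤ ∑ _h : Fin H, 1 :=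
        Finset.sum_le_sum fun h _ => by split_ifs <;> simp
    _ = H := by simp

theorem sum_episodeVisits_mul (e : Episode H S A) (f : S × A → ℝ) :
    ∑ z : S × A, (episodeVisits e z.1 z.2 : ℝ) * f z =
      ∑ h : Fin H, if (h : ℕ) + 1 < H then f (e h) else 0 := by
  classical
  simp only [episodeVisits, Nat.cast_sum, Finset.sum_mul]
  rw [Finset.sum_comm]
  refine Finset.sum_congr rfl fun h _ => ?_
  by_cases hh : (h : ℕ) + 1 < H <;> simp [hh]

theorem sum_episodeBonus_le (M : ℝ) {T : ℕ} (τ : History T H S A) :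
    ∑ t : Fin T, episodeBonus M (firstEpisodes τ t t.2.le) (τ t) ≤
      4 * H * (Fintype.card S * Fintype.card A) + 8 * Real.sqrt M *
        Real.sqrt (Fintype.card S * Fintype.card A * (T * H)) := by
  set m : S × A → ℕ → ℕ := fun z t =>
    if ht : t < T then episodeVisits (τ ⟨t, ht⟩) z.1 z.2 else 0 with hm
  have hmH : ∀ z t, m z t ≤ H := fun z t => by
    simp only [hm]; split_ifs; exacts [episodeVisits_le _ _ _, Nat.zero_le _]
  have hv : ∀ (z : S × A) (t : Fin T), visits (firstEpisodes τ t t.2.le) z.1 z.2 =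
      ∑ i ∈ Finset.range t, m z i := by
    intro z t
    rw [← Fin.sum_univ_eq_sum_range]
    refine Finset.sum_congr rfl fun i _ => ?_
    simp only [hm, i.2.trans t.2, dite_true]
    rfl
  have hmt : ∀ (z : S × A) (t : Fin T), m z t = episodeVisits (τ t) z.1 z.2 := fun z t => by
    simp [hm]
  have h1 : ∑ t : Fin T, episodeBonus M (firstEpisodes τ t t.2.le) (τ t) =
      ∑ z : S × A, ∑ t ∈ Finset.range T, (m z t : ℝ) * bonus M (∑ i ∈ Finset.range t, m z i) := by
    rw [Finset.sum_comm, ← Fin.sum_univ_eq_sum_range (fun t => ∑ z : S × A,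
      (m z t : ℝ) * bonus M (∑ i ∈ Finset.range t, m z i))]
    refine Finset.sum_congr rfl fun t _ => ?_
    simp only [hmt, ← hv]
    exact (sum_episodeVisits_mul (τ t)
      (fun z => bonus M (visits (firstEpisodes τ t t.2.le) z.1 z.2))).symm
  have hN : ∑ z : S × A, ((∑ i ∈ Finset.range T, m z i : ℕ) : ℝ) ≤ T * H := by
    push_cast
    rw [Finset.sum_comm]
    calc _ ≤ ∑ _t ∈ Finset.range T, (H : ℝ) := by
          refine Finset.sum_le_sum fun t ht => ?_
          have ht' := Finset.mem_range.1 ht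
          have h2 := sum_episodeVisits_mul (τ ⟨t, ht'⟩) (fun _ => 1)
          simp only [mul_one] at h2
          simp only [hm, ht', dite_true]
          rw [h2]
          calc _ ≤ ∑ _h : Fin H, (1 : ℝ) := Finset.sum_le_sum fun h _ => by
                split_ifs <;> norm_num
            _ = H := by simp
      _ = T * H := by simp
  have hcs : ∑ z : S × A, Real.sqrt ((∑ i ∈ Finset.range T, m z i : ℕ) : ℝ) ≤
      Real.sqrt (Fintype.card S * Fintype.card A * (T * H)) := by
    refine Real.le_sqrt_of_sq_le (sq_sum_le_card_mul_sum_sq.trans ?_)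
    simp only [Real.sq_sqrt (Nat.cast_nonneg _), Finset.card_univ, Fintype.card_prod]
    rw [Nat.cast_mul]
    exact mul_le_mul_of_nonneg_left hN (by positivity)
  rw [h1]
  refine (Finset.sum_le_sum fun z _ => sum_mul_bonus_le (M := M) (m z) (hmH z) T).trans ?_
  have hcs' := mul_le_mul_of_nonneg_left hcs (show 0 ≤ 8 * Real.sqrt M by positivity)
  rw [Finset.mul_sum] at hcs'
  rw [Finset.sum_add_distrib]
  refine add_le_add (le_of_eq ?_) hcs'
  simp only [Finset.sum_const, Finset.card_univ, Fintype.card_prod, nsmul_eq_mul, Nat.cast_mul]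
  ring

/-- The conditional expectation of the sum of the bonuses along the next episode. -/
noncomputable def expectedBonus (ρ : stdSimplex ℝ S) (P : Transition S A) (alg : Planner H S A)
    (M : ℝ) {k : ℕ} (τ : History k H S A) : ℝ :=
  ∑ e, episodeProb ρ P (alg k τ).2 e * episodeBonus M τ e

theorem expectedBonus_nonneg (ρ : stdSimplex ℝ S) (P : Transition S A) (alg : Planner H S A)
    (M : ℝ) {k : ℕ} (τ : History k H S A) : 0 ≤ expectedBonus ρ P alg M τ :=
  Finset.sum_nonneg fun _ _ => mul_nonneg (episodeProb_nonneg _ _ _ _) (episodeBonus_nonneg _ _ _)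

theorem exp_neg_le_one_sub_half {y : ℝ} (h0 : 0 ≤ y) (h1 : y ≤ 1) :
    Real.exp (-y) ≤ 1 - y / 2 := by
  rw [Real.exp_neg, inv_le_comm₀ (Real.exp_pos _) (by linarith)]
  refine le_trans ?_ (Real.add_one_le_exp y)
  rw [inv_le_iff_one_le_mul₀ (by linarith)]
  nlinarith

/-- Follows from `exp (-y) ≤ 1 - y / 2` on `[0, 1]`. Giving up a factor 2 in the mean avoids the
`√T` deviation term of Azuma's inequality. -/
theorem sum_mul_exp_neg_add_le_one {ι : Type*} [Fintype ι] (p y : ι → ℝ) (hp : ∀ i, 0 ≤ p i)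
    (hp1 : ∑ i, p i = 1) (h0 : ∀ i, 0 ≤ y i) (h1 : ∀ i, y i ≤ 1) :
    ∑ i, p i * Real.exp (-y i + (∑ j, p j * y j) / 2) ≤ 1 := by
  set μ := ∑ j, p j * y j with hμ
  simp only [Real.exp_add, ← mul_assoc, ← Finset.sum_mul]
  calc _ ≤ (∑ i, p i * (1 - y i / 2)) * Real.exp (μ / 2) := by
        gcongr with i
        · exact hp i
        · exact exp_neg_le_one_sub_half (h0 i) (h1 i)
    _ = (1 - μ / 2) * Real.exp (μ / 2) := by
        congr 1
        calc _ = ∑ i, p i - (∑ i, p i * y i) / 2 := by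
              rw [Finset.sum_div, ← Finset.sum_sub_distrib]
              exact Finset.sum_congr rfl fun i _ => by ring
          _ = _ := by rw [hp1]
    _ ≤ Real.exp (-(μ / 2)) * Real.exp (μ / 2) := by
        gcongr
        linarith [Real.add_one_le_exp (-(μ / 2))]
    _ = 1 := by rw [← Real.exp_add]; simp

/-- The exponential supermartingale comparing the bonuses with their conditional expectations. -/
noncomputable def bonusWeight (ρ : stdSimplex ℝ S) (P : Transition S A) (alg : Planner H S A)
    (M : ℝ) {T : ℕ} (τ : History T H S A) : ℝ :=
  Real.exp (∑ t : Fin T, (-(episodeBonus M (firstEpisodes τ t t.2.le) (τ t) / (2 * H)) +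
    expectedBonus ρ P alg M (firstEpisodes τ t t.2.le) / (2 * H) / 2))

theorem sum_runProb_mul_bonusWeight_le (ρ : stdSimplex ℝ S) (P : Transition S A)
    (alg : Planner H S A) (M : ℝ) (hH : 1 ≤ H) (T : ℕ) :
    ∑ τ : History T H S A, runProb ρ P alg τ * bonusWeight ρ P alg M τ ≤ 1 := by
  have hH' : (1 : ℝ) ≤ H := by exact_mod_cast hH
  simp only [bonusWeight, Real.exp_sum]
  refine sum_runProb_mul_prod_le ρ P alg (fun k τ e => Real.exp (-(episodeBonus M τ e / (2 * H)) +
    expectedBonus ρ P alg M τ / (2 * H) / 2)) (fun _ _ _ => (Real.exp_pos _).le) (fun k τ => ?_) T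
  have h := sum_mul_exp_neg_add_le_one (episodeProb ρ P (alg k τ).2)
    (fun e => episodeBonus M τ e / (2 * H)) (episodeProb_nonneg _ _ _) (sum_episodeProb _ _ _)
    (fun e => div_nonneg (episodeBonus_nonneg _ _ _) (by positivity))
    (fun e => by rw [div_le_one (by positivity)]; exact episodeBonus_le _ _ _)
  simpa only [expectedBonus, Finset.sum_div, mul_div_assoc] using h

theorem sum_expectedBonus_le (ρ : stdSimplex ℝ S) (P : Transition S A) (alg : Planner H S A)
    (M : ℝ) (hH : 1 ≤ H) {T : ℕ} (τ : History T H S A) {δ : ℝ} (h0 : 0 < δ)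
    (h : δ / 2 * bonusWeight ρ P alg M τ < 1) :
    ∑ t : Fin T, expectedBonus ρ P alg M (firstEpisodes τ t t.2.le) ≤
      2 * ∑ t : Fin T, episodeBonus M (firstEpisodes τ t t.2.le) (τ t) +
        4 * H * Real.log (2 / δ) := by
  have hH' : (1 : ℝ) ≤ H := by exact_mod_cast hH
  have h2 : bonusWeight ρ P alg M τ < 2 / δ := by
    rw [lt_div_iff₀ h0]; linarith
  have h3 := (Real.lt_log_iff_exp_lt (by positivity)).2 h2
  rw [Finset.sum_add_distrib, Finset.sum_neg_distrib, ← Finset.sum_div, ← Finset.sum_div,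
    ← Finset.sum_div] at h3
  field_simp at h3
  linarith

end Bonus

/-! ### Optimism, the regret bound and the failure probability. -/

section Regret

variable {n H : ℕ} {S A : Type*} [Fintype S] [Fintype A]

theorem ggw_sub_le (ρ : stdSimplex ℝ S) {r : Fin n → S → A → ℝ}
    (hr : ∀ i s a, r i s a ∈ Set.Icc (0 : ℝ) 1) {w : Fin n → ℝ} (h0 : ∀ j, 0 ≤ w j)
    (hw : Antitone w) (h1 : ∑ j, w j = 1) (π π' : Policy H S A) (P : Transition S A) :
    ggw ρ r w π P - ggw ρ r w π' P ≤ H := by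
  have := gini_le_gini_add h0 hw h1 (v := fun i => value ρ (r i) π P)
    (v' := fun i => value ρ (r i) π' P) (c := H) fun i => by
      linarith [(value_mem ρ (hr i) π P).2, (value_mem ρ (hr i) π' P).1]
  unfold ggw
  linarith

/-- Optimism bounds the comparator's true welfare by that of the played policy in the optimistic
model `Q`. Both `Q` and `P` are in the confidence set, so the triangle inequality through the
empirical law bounds their distance by the bonus. -/
theorem ggw_sub_le_expectedBonus (ρ : stdSimplex ℝ S) {r : Fin n → S → A → ℝ}
    (hr : ∀ i s a, r i s a ∈ Set.Icc (0 : ℝ) 1) {w : Fin n → ℝ} (h0 : ∀ j, 0 ≤ w j)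
    (hw : Antitone w) (h1 : ∑ j, w j = 1) {δ : ℝ} {alg : Planner H S A}
    (halg : IsUCRL (ggw ρ r w) δ alg) (π : Policy H S A) {P : Transition S A} {k : ℕ}
    {τ : History k H S A} (hP : P ∈ confidenceSet δ τ) {M : ℝ}
    (hM : 4 * (Fintype.card S : ℝ) * logFactor S A δ k ≤ M) :
    ggw ρ r w π P - ggw ρ r w (alg k τ).2 P ≤ H * expectedBonus ρ P alg M τ := by
  obtain ⟨hQ, hopt, -⟩ := halg k τ
  have hopt := hopt P hP π
  set Q := (alg k τ).1
  set σ := (alg k τ).2 with hσ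
  have hd : ∀ s a, ∑ s', |(Q s a).1 s' - (P s a).1 s'| ≤ bonus M (visits τ s a) := by
    intro s a
    refine le_min (sum_abs_sub_le_two _ _) ?_
    have e1 := hP s a
    have e2 := hQ s a
    have e3 : Real.sqrt (4 * (Fintype.card S : ℝ) * logFactor S A δ k /
        max 1 (visits τ s a : ℝ)) ≤ Real.sqrt (M / max 1 (visits τ s a : ℝ)) := by gcongr
    rw [logFactor] at e3
    calc _ ≤ ∑ s', (|(Q s a).1 s' - empirical τ s a s'| + |(P s a).1 s' - empirical τ s a s'|) :=
          Finset.sum_le_sum fun s' _ => by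
            rw [abs_sub_comm ((P s a).1 s')]; exact abs_sub_le _ _ _
      _ ≤ _ := by rw [Finset.sum_add_distrib]; linarith
  have hv : ∀ i, value ρ (r i) σ Q ≤ value ρ (r i) σ P + H * expectedBonus ρ P alg M τ := by
    intro i
    refine (value_le_value_add ρ (hr i) σ P Q).trans ?_
    unfold expectedBonus episodeBonus
    gcongr with e _ h _
    · exact episodeProb_nonneg _ _ _ _
    · split_ifs
      exacts [hd _ _, le_rfl]
  have := gini_le_gini_add h0 hw h1 hv
  unfold ggw at *
  linarith

theorem sum_ite_lt_le (H T : ℕ) :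
    ∑ t : Fin T, (if (t : ℕ) < H then (H : ℝ) else 0) ≤ H * H := by
  rw [Fin.sum_univ_eq_sum_range (fun t => if t < H then (H : ℝ) else 0), ← Finset.sum_filter,
    Finset.sum_const, nsmul_eq_mul]
  gcongr
  calc _ ≤ (Finset.range H).card := Finset.card_le_card fun x hx => by
        rw [Finset.mem_filter] at hx; exact Finset.mem_range.2 hx.2
    _ = H := Finset.card_range H

theorem logFactor_le_log [Nonempty S] [Nonempty A] {δ : ℝ} (h0 : 0 < δ) {k T : ℕ} (hk : k < T) :
    logFactor S A δ k ≤
      Real.log ((Fintype.card S : ℝ) * (Fintype.card A : ℝ) * (T : ℝ) / δ) := by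
  have hS' : (0 : ℝ) < Fintype.card S := by exact_mod_cast Fintype.card_pos
  have hA' : (0 : ℝ) < Fintype.card A := by exact_mod_cast Fintype.card_pos
  have hkT : (k : ℝ) + 1 ≤ T := by exact_mod_cast hk
  unfold logFactor
  refine Real.log_le_log (by positivity) ?_
  gcongr

theorem regret_le_mul (ρ : stdSimplex ℝ S) {r : Fin n → S → A → ℝ}
    (hr : ∀ i s a, r i s a ∈ Set.Icc (0 : ℝ) 1) {w : Fin n → ℝ} (h0 : ∀ j, 0 ≤ w j)
    (hw : Antitone w) (h1 : ∑ j, w j = 1) (P : Transition S A) (π : Policy H S A)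
    (alg : Planner H S A) {T : ℕ} (τ : History T H S A) :
    regret (ggw ρ r w) P π alg τ ≤ T * H := by
  calc _ ≤ ∑ _t : Fin T, (H : ℝ) :=
        Finset.sum_le_sum fun t _ => ggw_sub_le ρ hr h0 hw h1 _ _ _
    _ = T * H := by simp

/-- The regret bound on the event that the model is in the confidence sets of all episodes with
index at least `H` and that the sum of the bonuses is comparable to that of their conditional
expectations. -/
theorem regret_le [Nonempty A] (hS : 2 ≤ Fintype.card S) (hH : 1 ≤ H) (ρ : stdSimplex ℝ S)
    {r : Fin n → S → A → ℝ} (hr : ∀ i s a, r i s a ∈ Set.Icc (0 : ℝ) 1) {w : Fin n → ℝ}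
    (hw0 : ∀ j, 0 ≤ w j) (hw : Antitone w) (hw1 : ∑ j, w j = 1) {δ : ℝ} (h0 : 0 < δ) (h1 : δ < 1)
    {alg : Planner H S A} (halg : IsUCRL (ggw ρ r w) δ alg) (π : Policy H S A)
    (P : Transition S A) {T : ℕ} (hT : 1 ≤ T) (τ : History T H S A)
    (hP : ∀ t : Fin T, H ≤ (t : ℕ) → P ∈ confidenceSet δ (firstEpisodes τ t t.2.le)) {L : ℝ}
    (hL : L = Real.log ((Fintype.card S : ℝ) * (Fintype.card A : ℝ) * (T : ℝ) / δ))
    (hB : δ / 2 * bonusWeight ρ P alg (4 * Fintype.card S * L) τ < 1) :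
    regret (ggw ρ r w) P π alg τ ≤ 100 * (H : ℝ) ^ 2 * (Fintype.card S : ℝ) *
      Real.sqrt ((Fintype.card A : ℝ) * (T : ℝ)) * L := by
  have hSne : Nonempty S := Fintype.card_pos_iff.1 (by omega)
  have hS' : (2 : ℝ) ≤ Fintype.card S := by exact_mod_cast hS
  have hA' : (1 : ℝ) ≤ Fintype.card A := by exact_mod_cast Fintype.card_pos
  have hT' : (1 : ℝ) ≤ T := by exact_mod_cast hT
  have hH' : (1 : ℝ) ≤ H := by exact_mod_cast hH
  have hL2 : 1 / 2 ≤ L := hL ▸ half_le_log (two_le_of_card hS h0 h1 hT')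
  set s := (Fintype.card S : ℝ)
  set a := (Fintype.card A : ℝ)
  have hX1 : 1 ≤ Real.sqrt (a * T) := Real.one_le_sqrt.2 (by nlinarith)
  set X := s * Real.sqrt (a * T) with hX
  have hX1' : 1 ≤ X := by nlinarith
  suffices h : regret (ggw ρ r w) P π alg τ ≤ 100 * H ^ 2 * (X * L) by
    rw [hX] at h; linarith
  have hXL : X ≤ 2 * (X * L) := by nlinarith
  -- For `T ≤ a` the trivial bound `T * H` suffices; otherwise `a ≤ √(a * T)`, which absorbs the
  -- burn-in term `4 * H * (s * a)`.
  rcases le_total (T : ℝ) a with hTA | hTA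
  · have hTX : T ≤ X := by
      have : (T : ℝ) ≤ Real.sqrt (a * T) := Real.le_sqrt_of_sq_le (by nlinarith)
      nlinarith
    calc _ ≤ (T : ℝ) * H := regret_le_mul ρ hr hw0 hw hw1 P π alg τ
      _ ≤ (2 * (X * L)) * (H ^ 2) := by
          gcongr
          · linarith
          · nlinarith
      _ ≤ _ := by nlinarith [mul_nonneg (sq_nonneg (H : ℝ)) (show 0 ≤ X * L by linarith)]
  have hreg : regret (ggw ρ r w) P π alg τ ≤ H * H +
      H * ∑ t : Fin T, expectedBonus ρ P alg (4 * s * L) (firstEpisodes τ t t.2.le) := by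
    refine le_trans ?_ (add_le_add_left (sum_ite_lt_le H T) _)
    rw [Finset.mul_sum, ← Finset.sum_add_distrib]
    refine Finset.sum_le_sum fun t _ => ?_
    have hb := expectedBonus_nonneg ρ P alg (4 * s * L) (firstEpisodes τ t t.2.le)
    split_ifs with ht
    · have := ggw_sub_le ρ hr hw0 hw hw1 π (playedPolicy alg τ t) P
      nlinarith
    · rw [zero_add]
      refine ggw_sub_le_expectedBonus ρ hr hw0 hw hw1 halg π (hP t (not_lt.1 ht)) ?_
      gcongr
      exact hL ▸ logFactor_le_log h0 t.2
  have hsum := sum_expectedBonus_le ρ P alg _ hH τ h0 hB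
  have hbon : _ ≤ 4 * H * (s * a) + 8 * Real.sqrt (4 * s * L) * Real.sqrt (s * a * (T * H)) :=
    sum_episodeBonus_le (4 * s * L) τ
  have hlog : Real.log (2 / δ) ≤ L := by
    rw [hL]
    refine Real.log_le_log (by positivity) ?_
    have : 2 ≤ s * a := by nlinarith
    exact div_le_div_of_nonneg_right (by nlinarith) h0.le
  have hsa : s * a ≤ X := by
    rw [hX]
    gcongr
    exact Real.le_sqrt_of_sq_le (by nlinarith)
  have hroot : Real.sqrt (4 * s * L) * Real.sqrt (s * a * (T * H)) ≤ 4 * H * (X * L) := by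
    rw [← Real.sqrt_mul (by positivity)]
    refine Real.sqrt_le_iff.2 ⟨by positivity, ?_⟩
    have e1 : (4 * H * (X * L)) ^ 2 = 16 * H ^ 2 * L ^ 2 * (s ^ 2 * (a * T)) := by
      rw [hX, mul_pow, mul_pow, mul_pow, mul_pow, Real.sq_sqrt (by positivity)]; ring
    rw [e1]
    have e2 : 1 / 2 ≤ H * L := by nlinarith
    calc _ = 4 * (H * L) * (s ^ 2 * (a * T)) := by ring
      _ ≤ 16 * (H * L) ^ 2 * (s ^ 2 * (a * T)) :=
        mul_le_mul_of_nonneg_right (by nlinarith) (by positivity)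
      _ = _ := by ring
  have hHH : (0 : ℝ) ≤ H * H := by positivity
  have hH0 : (0 : ℝ) ≤ H := by linarith
  have f0 : 0 ≤ H * H * (X * L) := mul_nonneg hHH (by linarith)
  have f1 : H * H * (1 : ℝ) ≤ H * H * (2 * (X * L)) :=
    mul_le_mul_of_nonneg_left (by linarith) hHH
  have f2 : H * H * (s * a) ≤ H * H * (2 * (X * L)) :=
    mul_le_mul_of_nonneg_left (by linarith) hHH
  have f3 := mul_le_mul_of_nonneg_left hroot hH0
  have f4 : H * H * Real.log (2 / δ) ≤ H * H * (X * L) :=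
    mul_le_mul_of_nonneg_left (hlog.trans (le_mul_of_one_le_left (by linarith) hX1')) hHH
  have f5 := mul_le_mul_of_nonneg_left hsum hH0
  have f6 := mul_le_mul_of_nonneg_left hbon hH0
  -- In units of `H² * X * L`: 2 from the early episodes, 16 from the burn-in, 64 from the square
  -- root and 4 from `log (2 / δ)`, in total 86.
  linarith

open Classical in
/-- The sum of the exponential supermartingales, weighted by their share of the failure
probability. -/
noncomputable def failureWeight (δ : ℝ) (P : Transition S A) {k : ℕ} (τ : History k H S A) : ℝ :=
  ∑ s, ∑ a, ∑ x : S → Bool, ∑ n ∈ Finset.Icc 1 (k * H),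
    Real.exp (-(2 * Fintype.card S * logFactor S A δ k)) *
      Real.exp (∑ s', devExponent (P s a)
        (Real.sqrt (4 * Fintype.card S * logFactor S A δ k / n)) x s' *
          (transitions τ s a s' : ℝ))

theorem one_le_failureWeight [Nonempty A] (hS : 2 ≤ Fintype.card S) {δ : ℝ}
    (h0 : 0 < δ) (h1 : δ < 1) (P : Transition S A) {k : ℕ} (τ : History k H S A)
    (hP : P ∉ confidenceSet δ τ) : 1 ≤ failureWeight δ P τ := by
  obtain ⟨s, a, x, n, hn, h⟩ := exists_le_exp_of_notMem_confidenceSet hS h0 h1 P τ hP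
  refine h.trans ?_
  classical
  unfold failureWeight
  refine le_trans ?_ (Finset.single_le_sum (fun _ _ => by positivity) (Finset.mem_univ s))
  refine le_trans ?_ (Finset.single_le_sum (fun _ _ => by positivity) (Finset.mem_univ a))
  refine le_trans ?_ (Finset.single_le_sum (fun _ _ => by positivity) (Finset.mem_univ x))
  exact Finset.single_le_sum (f := fun n : ℕ =>
    Real.exp (-(2 * Fintype.card S * logFactor S A δ k)) *
      Real.exp (∑ s', devExponent (P s a)
        (Real.sqrt (4 * Fintype.card S * logFactor S A δ k / n)) x s' *
          (transitions τ s a s' : ℝ))) (fun _ _ => by positivity) hn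

theorem sum_le_card_mul {ι : Type*} (u : Finset ι) (f : ι → ℝ) (c : ℝ) (h : ∀ i ∈ u, f i ≤ c) :
    ∑ i ∈ u, f i ≤ (u.card : ℝ) * c := by
  simpa using Finset.sum_le_card_nsmul u f c h

/-- Each summand has mean at most its prefactor, by the supermartingale bound for a fixed guess of
the visit count; it remains to count the summands. -/
theorem sum_runProb_mul_failureWeight_le [Nonempty A] (hS : 2 ≤ Fintype.card S) {δ : ℝ}
    (h0 : 0 < δ) (h1 : δ < 1) (ρ : stdSimplex ℝ S) (P : Transition S A) (alg : Planner H S A)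
    (hH : 1 ≤ H) {k T : ℕ} (hk : H ≤ k) (hkT : k ≤ T) :
    ∑ τ : History T H S A, runProb ρ P alg τ * failureWeight δ P (firstEpisodes τ k hkT) ≤
      δ / 2 * (1 / (k : ℝ) - 1 / ((k : ℝ) + 1)) := by
  refine le_trans ?_ (confidence_weight_le (A := A) hS h0 h1 hH hk)
  classical
  simp only [failureWeight, Finset.mul_sum]
  rw [Finset.sum_comm]
  refine sum_le_card_mul _ _ _ fun s _ => ?_
  rw [Finset.sum_comm]
  refine sum_le_card_mul _ _ _ fun a _ => ?_
  rw [Finset.sum_comm]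
  refine (sum_le_card_mul _ _ ((k * H : ℕ) * Real.exp (-(2 * Fintype.card S * logFactor S A δ k)))
    fun x _ => ?_).trans (le_of_eq (by simp))
  rw [Finset.sum_comm]
  refine (sum_le_card_mul _ _ (Real.exp (-(2 * Fintype.card S * logFactor S A δ k)))
    fun m _ => ?_).trans (le_of_eq (by simp))
  have h := sum_runProb_mul_exp_transitions_le ρ P alg s a _ (sum_mul_exp_devExponent_le (P s a)
    (Real.sqrt (4 * Fintype.card S * logFactor S A δ k / m)) x) hkT
  refine le_trans (le_of_eq ?_)
    (mul_le_of_le_one_right (Real.exp_pos (-(2 * Fintype.card S * logFactor S A δ k))).le h)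
  rw [Finset.mul_sum]
  exact Finset.sum_congr rfl fun τ _ => by ring

theorem sum_ite_inv_sub_inv_le_one (hH : 1 ≤ H) (T : ℕ) :
    ∑ t : Fin T, (if H ≤ (t : ℕ) then 1 / ((t : ℕ) : ℝ) - 1 / (((t : ℕ) : ℝ) + 1) else 0) ≤ 1 := by
  rw [Fin.sum_univ_eq_sum_range
    (fun t => if H ≤ t then 1 / (t : ℝ) - 1 / ((t : ℝ) + 1) else 0)]
  rcases T with _ | T
  · simp
  suffices h : ∑ t ∈ Finset.range (T + 1),
      (if H ≤ t then 1 / (t : ℝ) - 1 / ((t : ℝ) + 1) else 0) ≤ 1 - 1 / ((T : ℝ) + 1) by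
    have : 0 ≤ 1 / ((T : ℝ) + 1) := by positivity
    linarith
  induction T with
  | zero => simp [show H ≠ 0 by omega]
  | succ T ih =>
    rw [Finset.sum_range_succ]
    have h : 1 / ((T : ℝ) + 1 + 1) ≤ 1 / ((T : ℝ) + 1) := by gcongr; linarith
    push_cast
    split_ifs <;> linarith

/-- The regret bound for at least two states and a positive horizon. -/
theorem one_sub_le_runPr_regret_le [Nonempty A] (hS : 2 ≤ Fintype.card S) (hH : 1 ≤ H)
    (ρ : stdSimplex ℝ S) {r : Fin n → S → A → ℝ} (hr : ∀ i s a, r i s a ∈ Set.Icc (0 : ℝ) 1)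
    {w : Fin n → ℝ} (hw0 : ∀ j, 0 ≤ w j) (hw : Antitone w) (hw1 : ∑ j, w j = 1) {δ : ℝ}
    (h0 : 0 < δ) (h1 : δ < 1) {alg : Planner H S A} (halg : IsUCRL (ggw ρ r w) δ alg)
    (π : Policy H S A) (P : Transition S A) {T : ℕ} (hT : 1 ≤ T) :
    1 - δ ≤ runPr ρ P alg {τ : History T H S A | regret (ggw ρ r w) P π alg τ ≤
      100 * (H : ℝ) ^ 2 * (Fintype.card S : ℝ) * Real.sqrt ((Fintype.card A : ℝ) * (T : ℝ)) *
        Real.log ((Fintype.card S : ℝ) * (Fintype.card A : ℝ) * (T : ℝ) / δ)} := by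
  set L := Real.log ((Fintype.card S : ℝ) * (Fintype.card A : ℝ) * (T : ℝ) / δ) with hL
  -- Each of the two parts has mean at most `δ / 2`; where `W < 1`, every term is below one, so all
  -- good events hold.
  set W : History T H S A → ℝ := fun τ =>
    ∑ t : Fin T, (if H ≤ (t : ℕ) then failureWeight δ P (firstEpisodes τ t t.2.le) else 0) +
      δ / 2 * bonusWeight ρ P alg (4 * Fintype.card S * L) τ with hW
  have hf0 : ∀ τ : History T H S A, ∀ t : Fin T,
      0 ≤ if H ≤ (t : ℕ) then failureWeight δ P (firstEpisodes τ t t.2.le) else 0 := by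
    intro τ t
    unfold failureWeight
    split_ifs <;> positivity
  have hb0 : ∀ τ : History T H S A,
      0 ≤ δ / 2 * bonusWeight ρ P alg (4 * Fintype.card S * L) τ := fun τ => by
    unfold bonusWeight; positivity
  refine le_trans ?_ (one_sub_le_runPr ρ P alg _ W
    (fun τ => add_nonneg (Finset.sum_nonneg fun t _ => hf0 τ t) (hb0 τ)) fun τ hτ => ?_)
  · have hsplit : ∑ τ, runProb ρ P alg τ * W τ = ∑ t : Fin T, (if H ≤ (t : ℕ) then
        ∑ τ : History T H S A, runProb ρ P alg τ * failureWeight δ P (firstEpisodes τ t t.2.le)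
          else 0) + δ / 2 * ∑ τ : History T H S A,
            runProb ρ P alg τ * bonusWeight ρ P alg (4 * Fintype.card S * L) τ := by
      simp only [hW, mul_add, Finset.sum_add_distrib, Finset.mul_sum]
      rw [Finset.sum_comm]
      congr 1
      · refine Finset.sum_congr rfl fun t _ => ?_
        split_ifs <;> simp
      · exact Finset.sum_congr rfl fun τ _ => by ring
    have hfail : ∑ t : Fin T, (if H ≤ (t : ℕ) then
        ∑ τ : History T H S A, runProb ρ P alg τ * failureWeight δ P (firstEpisodes τ t t.2.le)
          else 0) ≤ δ / 2 * 1 := by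
      refine le_trans ?_ (mul_le_mul_of_nonneg_left (sum_ite_inv_sub_inv_le_one hH T)
        (by positivity))
      rw [Finset.mul_sum]
      refine Finset.sum_le_sum fun t _ => ?_
      split_ifs with ht
      · exact sum_runProb_mul_failureWeight_le hS h0 h1 ρ P alg hH ht t.2.le
      · simp
    have hbon := mul_le_mul_of_nonneg_left
      (sum_runProb_mul_bonusWeight_le ρ P alg (4 * Fintype.card S * L) hH T)
      (show 0 ≤ δ / 2 by positivity)
    linarith
  · by_contra hlt
    rw [not_le] at hlt
    refine hτ (regret_le hS hH ρ hr hw0 hw hw1 h0 h1 halg π P hT τ (fun t ht => ?_) hL ?_)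
    · by_contra hP
      have e1 := one_le_failureWeight hS h0 h1 P _ hP
      have e2 := Finset.single_le_sum (fun t _ => hf0 τ t) (Finset.mem_univ t)
      simp only [ht, if_true] at e2
      have e3 := hb0 τ
      simp only [hW] at hlt
      linarith
    · have e2 := Finset.sum_nonneg fun (t : Fin T) (_ : t ∈ Finset.univ) => hf0 τ t
      simp only [hW] at hlt
      linarith

theorem runPr_eq_one (ρ : stdSimplex ℝ S) (P : Transition S A) (alg : Planner H S A) {T : ℕ}
    (E : Set (History T H S A)) (h : ∀ τ, τ ∈ E) : runPr ρ P alg E = 1 := by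
  rw [runPr, ← sum_runProb ρ P alg T]
  exact Finset.sum_congr rfl fun τ _ => if_pos (h τ)

end Regret

end FairRL

theorem mainTheorem5 :
    ∃ C : ℝ, 0 < C ∧
      ∀ (n H : ℕ) (S A : Type*) [Fintype S] [Fintype A] [Nonempty S] [Nonempty A]
        (ρ : stdSimplex ℝ S) (P : FairRL.Transition S A) (r : Fin n → S → A → ℝ)
        (w : Fin n → ℝ) (δ : ℝ) (alg : FairRL.Planner H S A) (πstar : FairRL.Policy H S A) (T : ℕ),
        (∀ i s a, r i s a ∈ Set.Icc (0 : ℝ) 1) →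
        (∀ j, 0 ≤ w j) → Antitone w → ∑ j, w j = 1 →
        0 < δ → δ < 1 →
        FairRL.IsUCRL (FairRL.ggw ρ r w) δ alg →
        (∀ π : FairRL.Policy H S A, FairRL.ggw ρ r w π P ≤ FairRL.ggw ρ r w πstar P) →
        1 - δ ≤ FairRL.runPr ρ P alg
          {τ : FairRL.History T H S A |
            FairRL.regret (FairRL.ggw ρ r w) P πstar alg τ ≤
              C * (H : ℝ) ^ 2 * (Fintype.card S : ℝ) *
                Real.sqrt ((Fintype.card A : ℝ) * (T : ℝ)) *
                Real.log ((Fintype.card S : ℝ) * (Fintype.card A : ℝ) * (T : ℝ) / δ)} := by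
  refine ⟨100, by norm_num, ?_⟩
  intro n H S A _ _ _ _ ρ P r w δ alg πstar T hr hw0 hw hw1 h0 h1 halg _
  have hS' : (1 : ℝ) ≤ Fintype.card S := by exact_mod_cast Fintype.card_pos
  have hA' : (1 : ℝ) ≤ Fintype.card A := by exact_mod_cast Fintype.card_pos
  have hbound : 0 ≤ 100 * (H : ℝ) ^ 2 * (Fintype.card S : ℝ) *
      Real.sqrt ((Fintype.card A : ℝ) * (T : ℝ)) *
        Real.log ((Fintype.card S : ℝ) * (Fintype.card A : ℝ) * (T : ℝ) / δ) := by
    rcases Nat.eq_zero_or_pos T with rfl | hT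
    · simp
    · have hT' : (1 : ℝ) ≤ T := by exact_mod_cast hT
      refine mul_nonneg (by positivity) (Real.log_nonneg ?_)
      rw [le_div_iff₀ h0]
      nlinarith [mul_le_mul hS' hA' zero_le_one (by positivity)]
  by_cases hcase : 2 ≤ Fintype.card S ∧ 1 ≤ H ∧ 1 ≤ T
  · exact FairRL.one_sub_le_runPr_regret_le hcase.1 hcase.2.1 ρ hr hw0 hw hw1 h0 h1 halg πstar P
      hcase.2.2
  · rw [FairRL.runPr_eq_one]
    · linarith
    intro τ
    refine le_trans ?_ hbound
    by_cases hHT : 1 ≤ H ∧ 1 ≤ T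
    · have hS1 : Fintype.card S ≤ 1 := by omega
      have : Subsingleton S := Fintype.card_le_one_iff_subsingleton.1 hS1
      -- On one state the simplex is a point, so the planner's model is the true one and its policy
      -- is optimal.
      have hsub : ∀ p q : stdSimplex ℝ S, p = q := fun p q => Subtype.ext <| funext fun s => by
        have hp := p.2.2
        have hq := q.2.2
        rw [Fintype.sum_subsingleton _ s] at hp hq
        rw [hp, hq]
      refine Finset.sum_nonpos fun t _ => sub_nonpos.2 ?_
      have h := (halg t (FairRL.firstEpisodes τ t t.2.le)).2.2 πstar
      rwa [show (alg t (FairRL.firstEpisodes τ t t.2.le)).1 = P from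
        funext fun s => funext fun a => hsub _ _] at h
    · refine (FairRL.regret_le_mul ρ hr hw0 hw hw1 P πstar alg τ).trans (le_of_eq ?_)
      rcases (show H = 0 ∨ T = 0 by omega) with rfl | rfl <;> simp
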